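/- Theorem 1.3. Let $R$ be a $d\times d$ integer matrix that is expansive (all its complex eigenvalues have modulus $>1$), let $B\subset\mathbb Z^d$ be finite with $0\in B$, and put $N=|B|$ and $\tau_b(x)=R^{-1}(x+b)$ for $x\in\mathbb R^d$, $b\in B$. Let $\mu=\mu(R,B)$ be the self-affine measure, i.e. the unique Borel probability measure on $\mathbb R^d$ with $\mu(E)=\frac1N\sum_{b\in B}\mu(\tau_b^{-1}(E))$ for all Borel sets $E$, and let $X_B=\{\sum_{k\ge1}R^{-k}b_k : b_k\in B\}$ be the attractor. Suppose that $\mu$ has no overlap: $\mu(\tau_b(X_B)\cap\tau_{b'}(X_B))=0$ for all $b\ne b'$ in $B$. Let $L\subset\mathbb Z^d$ be a finite set with $0\in L$ and let $(\alpha_l)_{l\in L}$ be complex numbers such that: (i) $\alpha_0=1$; (ii) the matrix $T=\frac1{\sqrt N}\left(e^{2\pi i (R^T)^{-1}l\cdot b}\,\alpha_l\right)_{l\in L,\,b\in B}$ is an isometry, i.e. $T^*T=I_N$; (iii) the only entire function $h$ on $\mathbb C^d$ such that $0\le h\le 1$ on $\mathbb R^d$, $h(0)=1$ and $$\sum_{l\in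 L}|\alpha_l|^2\left|m_B\big((R^T)^{-1}(t-l)\big)\right|^2h\big((R^T)^{-1}(t-l)\big)=h(t)\qquad(t\in\mathbb R^d)$$ is the constant function $1$, where $m_B(x)=\frac1N\sum_{b\in B}e^{2\pi i b\cdot x}$. Let $\Omega(L)=\{\emptyset\}\cup\{l_0\dots l_k : k\ge0,\ l_i\in L,\ l_k\ne0\}$ be the set consisting of the empty word and of all finite words over $L$ whose last digit is nonzero, and write $e_\lambda(x)=e^{2\pi i\lambda\cdot x}$. Then the family $$\left(\Big(\prod_{i=0}^k\alpha_{l_i}\Big)\,e_{l_0+R^Tl_1+\dots+(R^T)^kl_k}\right)_{l_0\dots l_k\in\Omega(L)},$$ in which the empty word gives the constant function $1$, is a Parseval frame for $L^2(\mu)$: for every $f\in L^2(\mu)$ the sum of $|\langle f,\cdot\rangle|^2$ over the family equals $\|f\|^2$. -/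

import Mathlib

open MeasureTheory
open scoped Matrix

namespace SelfAffine

noncomputable section

/-- An integer vector, seen in `ℝ^d`. -/
def toReal {d : ℕ} (l : Fin d → ℤ) : Fin d → ℝ := fun i => (l i : ℝ)

/-- An integer matrix, seen as a real matrix. -/
def realMatrix {d : ℕ} (R : Matrix (Fin d) (Fin d) ℤ) : Matrix (Fin d) (Fin d) ℝ :=
  R.map (fun a : ℤ => (a : ℝ))

/-- `R` is expansive: every complex eigenvalue has modulus greater than one. -/
def IsExpansive {d : ℕ} (R : Matrix (Fin d) (Fin d) ℤ) : Prop :=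
  ∀ z ∈ spectrum ℂ (R.map (fun a : ℤ => (a : ℂ))), 1 < ‖z‖

/-- The affine maps `τ_b x = R⁻¹ (x + b)`. -/
def tau {d : ℕ} (R : Matrix (Fin d) (Fin d) ℤ) (b : Fin d → ℤ) (x : Fin d → ℝ) : Fin d → ℝ :=
  (realMatrix R)⁻¹ *ᵥ (x + toReal b)

/-- The self-affine measure `μ(R, B)` with equal weights, through its defining invariance
equation: for expansive `R` and nonempty `B` exactly one Borel probability measure satisfies it. -/
def IsSelfAffineMeasure {d : ℕ} (R : Matrix (Fin d) (Fin d) ℤ) (B : Finset (Fin d → ℤ))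
    (μ : Measure (Fin d → ℝ)) [IsProbabilityMeasure μ] : Prop :=
  ∀ E : Set (Fin d → ℝ), MeasurableSet E →
    μ E = (B.card : ENNReal)⁻¹ * ∑ b ∈ B, μ (tau R b ⁻¹' E)

/-- The attractor `X_B`: all sums `∑_{k ≥ 1} R^{-k} b_k` with digits `b_k ∈ B`. -/
def attractor {d : ℕ} (R : Matrix (Fin d) (Fin d) ℤ) (B : Finset (Fin d → ℤ)) :
    Set (Fin d → ℝ) :=
  {x | ∃ b : ℕ → B, HasSum (fun k : ℕ => ((realMatrix R)⁻¹ ^ (k + 1)) *ᵥ toReal (b k).1) x}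

/-- The no overlap condition. -/
def NoOverlap {d : ℕ} (R : Matrix (Fin d) (Fin d) ℤ) (B : Finset (Fin d → ℤ))
    (μ : Measure (Fin d → ℝ)) : Prop :=
  ∀ b ∈ B, ∀ b' ∈ B, b ≠ b' →
    μ (tau R b '' attractor R B ∩ tau R b' '' attractor R B) = 0

/-- The exponential function `e_t(x) = exp(2πi t·x)`. -/
def expo {d : ℕ} (t x : Fin d → ℝ) : ℂ :=
  Complex.exp (2 * Real.pi * Complex.I * ((t ⬝ᵥ x : ℝ) : ℂ))

theorem norm_expo {d : ℕ} (t x : Fin d → ℝ) : ‖expo t x‖ = 1 := by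
  have : (2 * Real.pi * Complex.I * ((t ⬝ᵥ x : ℝ) : ℂ) : ℂ)
      = ((2 * Real.pi * (t ⬝ᵥ x) : ℝ) : ℂ) * Complex.I := by
    push_cast; ring
  rw [expo, this, Complex.norm_exp_ofReal_mul_I]

theorem continuous_expo {d : ℕ} (t : Fin d → ℝ) : Continuous (expo t) := by
  unfold expo dotProduct
  fun_prop

theorem memLp_expo {d : ℕ} (μ : Measure (Fin d → ℝ)) [IsFiniteMeasure μ] (t : Fin d → ℝ) :
    MemLp (expo t) 2 μ :=
  MemLp.of_bound (continuous_expo t).aestronglyMeasurable 1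
    (Filter.Eventually.of_forall fun x => (norm_expo t x).le)

/-- The exponential function `e_t` as an element of `L²(μ)`. -/
def expoLp {d : ℕ} (μ : Measure (Fin d → ℝ)) [IsFiniteMeasure μ] (t : Fin d → ℝ) : Lp ℂ 2 μ :=
  (memLp_expo μ t).toLp (expo t)

/-- The map `g_l(t) = (Rᵀ)⁻¹ (t - l)`. -/
def dualMap {d : ℕ} (R : Matrix (Fin d) (Fin d) ℤ) (l : Fin d → ℤ) (t : Fin d → ℝ) :
    Fin d → ℝ :=
  ((realMatrix R)ᵀ)⁻¹ *ᵥ (t - toReal l)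

/-- `m_B(x) = (1/N) ∑_{b ∈ B} exp(2πi b·x)`. -/
def mask {d : ℕ} (B : Finset (Fin d → ℤ)) (x : Fin d → ℝ) : ℂ :=
  (B.card : ℂ)⁻¹ * ∑ b ∈ B, expo (toReal b) x

/-- The matrix `T = (1/√N) (exp(2πi (Rᵀ)⁻¹ l · b) α_l)`, with rows `l ∈ L`, columns `b ∈ B`. -/
def weightMatrix {d : ℕ} (R : Matrix (Fin d) (Fin d) ℤ) (B L : Finset (Fin d → ℤ))
    (α : L → ℂ) : Matrix L B ℂ :=
  Matrix.of fun l b =>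
    ((Real.sqrt (B.card : ℝ) : ℝ) : ℂ)⁻¹ *
      (expo (((realMatrix R)ᵀ)⁻¹ *ᵥ toReal l.1) (toReal b.1) * α l)

/-- The fixed point equation of the weighted transfer operator, at all real points `t`, for a
function `h` on `ℂ^d`. -/
def IsTransferFixed {d : ℕ} (R : Matrix (Fin d) (Fin d) ℤ) (B L : Finset (Fin d → ℤ))
    (α : L → ℂ) (h : (Fin d → ℂ) → ℂ) : Prop :=
  ∀ t : Fin d → ℝ,
    ∑ l : L, ((‖α l‖ ^ 2 * ‖mask B (dualMap R l.1 t)‖ ^ 2 : ℝ) : ℂ) *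
      h (fun i => (dualMap R l.1 t i : ℂ)) = h (fun i => (t i : ℂ))

/-- `Ω(L)`: finite words over `L`, either empty or with nonzero last digit. -/
def Words {d : ℕ} (L : Finset (Fin d → ℤ)) : Type :=
  {w : List L // ∀ hw : w ≠ [], (w.getLast hw).1 ≠ 0}

/-- The frequency `l_0 + Rᵀ l_1 + ⋯ + (Rᵀ)^k l_k` of a word `l_0 … l_k`. -/
def frequency {d : ℕ} (R : Matrix (Fin d) (Fin d) ℤ) {L : Finset (Fin d → ℤ)} (w : List L) :
    Fin d → ℤ :=
  ∑ i : Fin w.length, (Rᵀ ^ (i : ℕ)) *ᵥ (w.get i).1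

/-- The weighted exponential `(∏ α_{l_i}) e_{l_0 + Rᵀ l_1 + ⋯ + (Rᵀ)^k l_k}` in `L²(μ)`;
for the empty word it is the constant function one. -/
def weightedExpo {d : ℕ} (R : Matrix (Fin d) (Fin d) ℤ) {L : Finset (Fin d → ℤ)} (α : L → ℂ)
    (μ : Measure (Fin d → ℝ)) [IsFiniteMeasure μ] (w : Words L) : Lp ℂ 2 μ :=
  (w.1.map α).prod • expoLp μ (toReal (frequency R w.1))

/-- A Parseval frame: both frame bounds are one. -/
def IsParsevalFrame {ι H : Type*} [NormedAddCommGroup H] [InnerProductSpace ℂ H]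
    (e : ι → H) : Prop :=
  ∀ v : H, HasSum (fun i => ‖inner ℂ (e i) v‖ ^ 2) (‖v‖ ^ 2)

end

end SelfAffine

/-!
For `l ∈ L` let `A_l` be the operator `A_l f = N⁻¹ ∑_b conj(α_l e_l(τ_b x)) f(τ_b x)` on `L²(μ)`.
Invariance of `μ` and `T* T = 1` give `∑_l ‖A_l f‖² = ‖f‖²`, and pairing `f` with the weighted
exponential of a word `l w` is pairing `A_l f` with that of `w`. Induction on the word length
therefore shows that the family satisfies Bessel's inequality, and the frame sum of `f` is the sum
over `l` of the frame sums of `A_l f`. As `A_l` maps `e_t` to `conj(α_l) m_B(g_l t) e_{g_l t}`,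
where `g_l t = (Rᵀ)⁻¹ (t - l)`, the frame sum of `e_t` is, as a function of `t`, a fixed point of
the transfer operator. It extends to an entire function because `μ` has bounded support, so it is
constantly `1`. The analysis operator is thus a contraction that preserves the norms of the
exponentials; these span a dense subspace, and it is an isometry.
-/

namespace SelfAffine

noncomputable section

open Filter Topology
open scoped ENNReal NNReal ComplexConjugate BoundedContinuousFunction InnerProductSpace

section Contraction

open ContinuousLinearMap

variable {𝕜 κ E F : Type*} [RCLike 𝕜]
  [NormedAddCommGroup E] [InnerProductSpace 𝕜 E] [CompleteSpace E]
  [NormedAddCommGroup F] [InnerProductSpace 𝕜 F] [CompleteSpace F]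

theorem adjoint_apply_apply_of_norm_eq {Θ : E →L[𝕜] F} (hΘ : ‖Θ‖ ≤ 1) {v : E}
    (hv : ‖Θ v‖ = ‖v‖) : adjoint Θ (Θ v) = v := by
  have hle : ‖adjoint Θ (Θ v)‖ ≤ ‖v‖ := by
    rw [← hv]
    refine (adjoint Θ).le_of_opNorm_le_of_le ?_ le_rfl |>.trans_eq (one_mul _)
    rwa [LinearIsometryEquiv.norm_map]
  have hre : RCLike.re ⟪adjoint Θ (Θ v), v⟫_𝕜 = ‖v‖ ^ 2 := by
    rw [adjoint_inner_left, inner_self_eq_norm_sq, hv]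
  have hsub : ‖adjoint Θ (Θ v) - v‖ ^ 2 ≤ 0 := by
    rw [norm_sub_sq (𝕜 := 𝕜), hre]
    linarith [pow_le_pow_left₀ (norm_nonneg _) hle 2]
  rw [← sub_eq_zero, ← norm_eq_zero]
  exact pow_eq_zero_iff two_ne_zero |>.mp (hsub.antisymm (sq_nonneg _))

theorem norm_apply_eq_of_dense {Θ : E →L[𝕜] F} (hΘ : ‖Θ‖ ≤ 1) {g : κ → E}
    (hg : Dense (Submodule.span 𝕜 (Set.range g) : Set E)) (h : ∀ k, ‖Θ (g k)‖ = ‖g k‖) (v : E) :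
    ‖Θ v‖ = ‖v‖ := by
  refine (norm_map_iff_adjoint_comp_self Θ).mpr (ext_on hg ?_) v
  rintro _ ⟨k, rfl⟩
  exact adjoint_apply_apply_of_norm_eq hΘ (h k)

end Contraction

section BesselFamily

variable {ι H : Type*} [NormedAddCommGroup H] [InnerProductSpace ℂ H]

/-- A family with upper frame bound one: Bessel's inequality holds for it. -/
def IsBesselFamily (e : ι → H) : Prop :=
  ∀ (v : H) (s : Finset ι), ∑ i ∈ s, ‖⟪e i, v⟫_ℂ‖ ^ 2 ≤ ‖v‖ ^ 2

/-- The frame sum `∑ |⟨e_i, v⟩|²`; the junk value `0` of a divergent sum does not occur for Bessel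
families. -/
def frameSum (e : ι → H) (v : H) : ℝ := ∑' i, ‖⟪e i, v⟫_ℂ‖ ^ 2

namespace IsBesselFamily

variable {e : ι → H}

theorem hasSum_frameSum (he : IsBesselFamily e) (v : H) :
    HasSum (fun i => ‖⟪e i, v⟫_ℂ‖ ^ 2) (frameSum e v) :=
  (summable_of_sum_le (fun _ => sq_nonneg _) (he v)).hasSum

theorem frameSum_le (he : IsBesselFamily e) (v : H) : frameSum e v ≤ ‖v‖ ^ 2 :=
  (he.hasSum_frameSum v).summable.tsum_le_of_sum_le (he v)

/-- The analysis operator `v ↦ (⟨e_i, v⟩)_i` into `ℓ²`. -/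
def analysisOp (he : IsBesselFamily e) : H →L[ℂ] lp (fun _ : ι => ℂ) 2 :=
  LinearMap.mkContinuous
    { toFun := fun v => ⟨fun i => ⟪e i, v⟫_ℂ,
        memℓp_gen (by simpa using (he.hasSum_frameSum v).summable)⟩
      map_add' := fun _ _ => Subtype.ext (funext fun _ => inner_add_right _ _ _)
      map_smul' := fun _ _ => Subtype.ext (funext fun _ => inner_smul_right _ _ _) } 1
    fun v => by
      rw [one_mul]
      exact lp.norm_le_of_forall_sum_le (by norm_num) (norm_nonneg _)
        fun s => by simpa using he v s

theorem norm_sq_analysisOp (he : IsBesselFamily e) (v : H) :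
    ‖he.analysisOp v‖ ^ 2 = frameSum e v := by
  have h := lp.hasSum_norm (p := 2) (by norm_num) (he.analysisOp v)
  simp only [ENNReal.toReal_ofNat, Real.rpow_ofNat] at h
  exact h.unique (he.hasSum_frameSum v)

end IsBesselFamily

theorem IsBesselFamily.isParsevalFrame_of_dense [CompleteSpace H] {κ : Type*} {e : ι → H}
    (he : IsBesselFamily e) {g : κ → H} (hg : Dense (Submodule.span ℂ (Set.range g) : Set H))
    (h : ∀ k, frameSum e (g k) = ‖g k‖ ^ 2) : IsParsevalFrame e := by
  intro v
  have hΘ : ‖he.analysisOp‖ ≤ 1 := LinearMap.mkContinuous_norm_le _ zero_le_one _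
  have hiso (k : κ) : ‖he.analysisOp (g k)‖ = ‖g k‖ := by
    rw [← sq_eq_sq₀ (norm_nonneg _) (norm_nonneg _), he.norm_sq_analysisOp, h]
  rw [← norm_apply_eq_of_dense hΘ hg hiso v, he.norm_sq_analysisOp]
  exact he.hasSum_frameSum v

end BesselFamily

section Words

variable {d : ℕ} {L : Finset (Fin d → ℤ)} {H : Type*} [NormedAddCommGroup H]
  [InnerProductSpace ℂ H]

namespace Words

/-- The empty word. -/
def nil : Words L := ⟨[], fun h => absurd rfl h⟩

/-- First digit and remainder of a word of `Ω(L)`. The empty word is read as `0` followed by the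
empty word, which makes this a bijection `Ω(L) ≃ L × Ω(L)`. -/
def uncons (hL : (0 : Fin d → ℤ) ∈ L) : Words L → L × Words L
  | ⟨[], _⟩ => (⟨0, hL⟩, nil)
  | ⟨l :: w, h⟩ => (l, ⟨w, fun hw => by
      simpa only [List.getLast_cons hw] using h (List.cons_ne_nil l w)⟩)

theorem uncons_bijective (hL : (0 : Fin d → ℤ) ∈ L) : Function.Bijective (uncons hL) := by
  constructor
  · rintro ⟨_ | ⟨l, v⟩, hv⟩ ⟨_ | ⟨m, w⟩, hw⟩ h <;>
      obtain ⟨hdigit, hrest⟩ := And.intro (congrArg Prod.fst h)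
        (congrArg (fun p : L × Words L => p.2.1) h) <;>
      simp only [uncons, nil] at hdigit hrest
    · rfl
    · subst hdigit hrest
      exact absurd rfl (hw (List.cons_ne_nil _ _))
    · subst hdigit hrest
      exact absurd rfl (hv (List.cons_ne_nil _ _))
    · exact Subtype.ext (congrArg₂ List.cons hdigit hrest)
  · rintro ⟨l, w, hw⟩
    by_cases h : l.1 = 0 ∧ w = []
    · obtain ⟨hl, rfl⟩ := h
      exact ⟨nil, Prod.ext (Subtype.ext hl.symm) rfl⟩
    · refine ⟨⟨l :: w, fun _ => ?_⟩, rfl⟩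
      obtain rfl | hne := eq_or_ne w []
      · simpa using h
      · simpa only [List.getLast_cons hne] using hw hne

theorem length_uncons_le {hL : (0 : Fin d → ℤ) ∈ L} {n : ℕ} :
    ∀ {w : Words L}, w.1.length ≤ n + 1 → (uncons hL w).2.1.length ≤ n
  | ⟨[], _⟩, _ => Nat.zero_le n
  | ⟨_ :: _, _⟩, h => Nat.succ_le_succ_iff.mp h

end Words

variable {hL : (0 : Fin d → ℤ) ∈ L} {A : L → H → H} {e : Words L → H}

theorem sum_norm_sq_inner_le_of_length_le (hA : ∀ f, ∑ l, ‖A l f‖ ^ 2 = ‖f‖ ^ 2)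
    (he : ∀ w f, ⟪e w, f⟫_ℂ = ⟪e (w.uncons hL).2, A (w.uncons hL).1 f⟫_ℂ)
    (hnil : ‖e Words.nil‖ ≤ 1) (n : ℕ) (f : H) (s : Finset (Words L))
    (hs : ∀ w ∈ s, w.1.length ≤ n) : ∑ w ∈ s, ‖⟪e w, f⟫_ℂ‖ ^ 2 ≤ ‖f‖ ^ 2 := by
  classical
  induction n generalizing f s with
  | zero =>
    have hsub : s ⊆ {Words.nil} := fun w hw => Finset.mem_singleton.mpr
      (Subtype.ext (List.length_eq_zero_iff.mp (Nat.le_zero.mp (hs w hw))))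
    calc ∑ w ∈ s, ‖⟪e w, f⟫_ℂ‖ ^ 2
        ≤ ∑ w ∈ {Words.nil}, ‖⟪e w, f⟫_ℂ‖ ^ 2 :=
          Finset.sum_le_sum_of_subset_of_nonneg hsub fun _ _ _ => sq_nonneg _
      _ = ‖⟪e Words.nil, f⟫_ℂ‖ ^ 2 := Finset.sum_singleton _ _
      _ ≤ (1 * ‖f‖) ^ 2 := by
          gcongr
          exact (norm_inner_le_norm _ _).trans (by gcongr)
      _ = ‖f‖ ^ 2 := by rw [one_mul]
  | succ n ih =>
    let t : Finset (Words L) := s.image fun w => (w.uncons hL).2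
    have hsub : s.image (Words.uncons hL) ⊆ Finset.univ ×ˢ t := by
      intro p hp
      obtain ⟨w, hw, rfl⟩ := Finset.mem_image.mp hp
      exact Finset.mem_product.mpr ⟨Finset.mem_univ _, Finset.mem_image_of_mem _ hw⟩
    have ht : ∀ w ∈ t, w.1.length ≤ n := by
      simpa only [t, Finset.forall_mem_image] using fun w hw => Words.length_uncons_le (hs w hw)
    calc ∑ w ∈ s, ‖⟪e w, f⟫_ℂ‖ ^ 2
        = ∑ p ∈ s.image (Words.uncons hL), ‖⟪e p.2, A p.1 f⟫_ℂ‖ ^ 2 := by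
          rw [Finset.sum_image (Words.uncons_bijective hL).injective.injOn]
          simp only [← he]
      _ ≤ ∑ p ∈ Finset.univ ×ˢ t, ‖⟪e p.2, A p.1 f⟫_ℂ‖ ^ 2 :=
          Finset.sum_le_sum_of_subset_of_nonneg hsub fun _ _ _ => sq_nonneg _
      _ = ∑ l, ∑ w ∈ t, ‖⟪e w, A l f⟫_ℂ‖ ^ 2 := Finset.sum_product _ _ _
      _ ≤ ∑ l, ‖A l f‖ ^ 2 := Finset.sum_le_sum fun l _ => ih (A l f) t ht
      _ = ‖f‖ ^ 2 := hA f

theorem isBesselFamily_of_inner_uncons (hA : ∀ f, ∑ l, ‖A l f‖ ^ 2 = ‖f‖ ^ 2)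
    (he : ∀ w f, ⟪e w, f⟫_ℂ = ⟪e (w.uncons hL).2, A (w.uncons hL).1 f⟫_ℂ)
    (hnil : ‖e Words.nil‖ ≤ 1) : IsBesselFamily e := fun f s =>
  sum_norm_sq_inner_le_of_length_le hA he hnil (s.sup fun w => w.1.length) f s
    fun _ hw => Finset.le_sup (f := fun w : Words L => w.1.length) hw

theorem IsBesselFamily.frameSum_eq_sum_of_inner_uncons (hbessel : IsBesselFamily e)
    (he : ∀ w f, ⟪e w, f⟫_ℂ = ⟪e (w.uncons hL).2, A (w.uncons hL).1 f⟫_ℂ) (f : H) :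
    frameSum e f = ∑ l, frameSum e (A l f) := by
  have hprod : HasSum (fun p : L × Words L => ‖⟪e p.2, A p.1 f⟫_ℂ‖ ^ 2) (frameSum e f) := by
    rw [← (Equiv.ofBijective _ (Words.uncons_bijective hL)).hasSum_iff]
    simpa only [Function.comp_def, Equiv.ofBijective_apply, ← he]
      using hbessel.hasSum_frameSum f
  exact (hprod.prod_fiberwise fun l => hbessel.hasSum_frameSum (A l f)).unique (hasSum_fintype _)

end Words

section PowerDecay

theorem summable_norm_pow_of_spectralRadius_lt_one {A : Type*} [NormedRing A] [NormedAlgebra ℂ A]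
    [CompleteSpace A] {a : A} (ha : spectralRadius ℂ a < 1) : Summable fun n : ℕ => ‖a ^ n‖ := by
  obtain ⟨r, har, hr⟩ := ENNReal.lt_iff_exists_nnreal_btwn.mp ha
  have hbound : ∀ᶠ n : ℕ in atTop, ‖a ^ n‖ ≤ (r : ℝ) ^ n := by
    filter_upwards [(spectrum.pow_nnnorm_pow_one_div_tendsto_nhds_spectralRadius a).eventually
      (gt_mem_nhds har), eventually_gt_atTop 0] with n hn hpos
    have hpow := pow_le_pow_left' hn.le n
    rw [← ENNReal.rpow_natCast, ← ENNReal.rpow_mul, one_div, inv_mul_cancel₀ (by positivity),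
      ENNReal.rpow_one] at hpow
    exact_mod_cast hpow
  refine (summable_geometric_of_lt_one r.2 (by exact_mod_cast hr)).of_norm_bounded_eventually_nat ?_
  filter_upwards [hbound] with n hn using by simpa using hn

theorem spectralRadius_inv_lt_one {A : Type*} [NormedRing A] [NormedAlgebra ℂ A]
    [CompleteSpace A] {u : Aˣ} (hu : ∀ z ∈ spectrum ℂ (u : A), 1 < ‖z‖) :
    spectralRadius ℂ (↑u⁻¹ : A) < 1 := by
  nontriviality A
  refine mod_cast spectrum.spectralRadius_lt_of_forall_lt (r := 1) (↑u⁻¹ : A) fun z hz => ?_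
  rw [← spectrum.map_inv, Set.mem_inv] at hz
  have hinv : 1 < ‖z‖⁻¹ := norm_inv z ▸ hu _ hz
  exact_mod_cast (one_lt_inv₀ (inv_pos.mp (one_pos.trans hinv))).mp hinv

attribute [local instance] Matrix.linftyOpNormedRing Matrix.linftyOpNormedAlgebra
  Matrix.linftyOpNormedAddCommGroup

variable {d : ℕ} {R : Matrix (Fin d) (Fin d) ℤ}

theorem IsExpansive.det_ne_zero (hR : IsExpansive R) : R.det ≠ 0 := by
  intro hdet
  have hmem : (0 : ℂ) ∈ spectrum ℂ (R.map fun a : ℤ => (a : ℂ)) := by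
    rw [spectrum.zero_mem_iff, Matrix.isUnit_iff_isUnit_det, ← Int.cast_det, hdet]
    simp
  exact absurd (hR 0 hmem) (by simp)

theorem IsExpansive.isUnit_det (hR : IsExpansive R) : IsUnit (realMatrix R).det := by
  rw [realMatrix, ← Int.cast_det]
  exact isUnit_iff_ne_zero.mpr (Int.cast_ne_zero.mpr hR.det_ne_zero)

theorem IsExpansive.summable_norm_inv_pow (hR : IsExpansive R) :
    Summable fun n : ℕ => ‖(realMatrix R)⁻¹ ^ n‖ := by
  let u : (Matrix (Fin d) (Fin d) ℝ)ˣ := Matrix.nonsingInvUnit (realMatrix R) hR.isUnit_det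
  let c := Complex.ofRealHom.mapMatrix (m := Fin d)
  have hc : c (realMatrix R) = R.map fun a : ℤ => (a : ℂ) := by
    ext i j
    simp [c, realMatrix]
  have hnorm (M : Matrix (Fin d) (Fin d) ℝ) : ‖c M‖ = ‖M‖ := by
    simp [c, Matrix.linfty_opNorm_def]
  have hrad : spectralRadius ℂ (↑(Units.map c.toMonoidHom u)⁻¹ : Matrix (Fin d) (Fin d) ℂ) < 1 :=
    spectralRadius_inv_lt_one fun z hz => hR z (hc ▸ hz)
  refine (summable_norm_pow_of_spectralRadius_lt_one hrad).congr fun n => ?_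
  rw [← hnorm, map_pow]
  rfl

end PowerDecay

section StationaryMeasure

variable {X ι E : Type*} [NormedAddCommGroup E]

/-- The average `|s|⁻¹ ∑_{i ∈ s} f ∘ τ_i` of a function over finitely many maps. -/
def average [NormedSpace ℝ E] (s : Finset ι) (τ : ι → X → X) (f : X → E) (x : X) : E :=
  (s.card : ℝ)⁻¹ • ∑ i ∈ s, f (τ i x)

variable [MeasurableSpace X]

/-- `μ` is stationary for the random walk applying a uniformly chosen map `τ_i`, `i ∈ s`, at each
step. The invariance equation is multiplied by `|s|`. -/
structure IsStationary (s : Finset ι) (τ : ι → X → X) (μ : Measure X) : Prop where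
  nonempty : s.Nonempty
  measurable : ∀ i ∈ s, Measurable (τ i)
  card_smul : (s.card : ℝ≥0∞) • μ = ∑ i ∈ s, μ.map (τ i)

namespace IsStationary

variable {s : Finset ι} {τ : ι → X → X} {μ : Measure X}

theorem map_le (hμ : IsStationary s τ μ) {i : ι} (hi : i ∈ s) :
    μ.map (τ i) ≤ (s.card : ℝ≥0∞) • μ := by
  classical
  rw [hμ.card_smul, ← Finset.add_sum_erase _ _ hi]
  exact Measure.le_add_right le_rfl

theorem quasiMeasurePreserving (hμ : IsStationary s τ μ) {i : ι} (hi : i ∈ s) :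
    Measure.QuasiMeasurePreserving (τ i) μ μ :=
  ⟨hμ.measurable i hi, Measure.absolutelyContinuous_of_le_smul (hμ.map_le hi)⟩

theorem measure_le_of_subset_preimage (hμ : IsStationary s τ μ) {U V : Set X}
    (hV : MeasurableSet V) (h : ∀ i ∈ s, U ⊆ τ i ⁻¹' V) : μ U ≤ μ V := by
  have hcard : (s.card : ℝ≥0∞) ≠ 0 := Nat.cast_ne_zero.mpr hμ.nonempty.card_ne_zero
  rw [← ENNReal.mul_le_mul_iff_right hcard (ENNReal.natCast_ne_top _)]
  calc (s.card : ℝ≥0∞) * μ U = ∑ _i ∈ s, μ U := by rw [Finset.sum_const, nsmul_eq_mul]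
    _ ≤ ∑ i ∈ s, μ.map (τ i) V := Finset.sum_le_sum fun i hi => by
        rw [Measure.map_apply (hμ.measurable i hi) hV]
        exact measure_mono (h i hi)
    _ = s.card * μ V := by
        rw [← Measure.finsetSum_apply, ← hμ.card_smul, Measure.smul_apply, smul_eq_mul]

theorem memLp_comp (hμ : IsStationary s τ μ) {i : ι} (hi : i ∈ s) {p : ℝ≥0∞} {f : X → E}
    (hf : MemLp f p μ) : MemLp (fun x => f (τ i x)) p μ :=
  (hf.of_measure_le_smul (ENNReal.natCast_ne_top _) (hμ.map_le hi)).comp_of_map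
    (hμ.measurable i hi).aemeasurable

variable [NormedSpace ℝ E]

theorem memLp_average (hμ : IsStationary s τ μ) {p : ℝ≥0∞} {f : X → E} (hf : MemLp f p μ) :
    MemLp (average s τ f) p μ :=
  have hsum : MemLp (fun x => ∑ i ∈ s, f (τ i x)) p μ :=
    memLp_finsetSum s fun _ hi => hμ.memLp_comp hi hf
  hsum.const_smul _

theorem average_congr_ae (hμ : IsStationary s τ μ) {f g : X → E} (h : f =ᵐ[μ] g) :
    average s τ f =ᵐ[μ] average s τ g := by
  have hcomp : ∀ᵐ x ∂μ, ∀ i ∈ s, f (τ i x) = g (τ i x) :=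
    (eventually_all_finset s).mpr fun i hi => (hμ.quasiMeasurePreserving hi).ae h
  filter_upwards [hcomp] with x hx
  rw [average, average, Finset.sum_congr rfl hx]

theorem integral_average (hμ : IsStationary s τ μ) {f : X → E} (hf : Integrable f μ) :
    ∫ x, average s τ f x ∂μ = ∫ x, f x ∂μ := by
  have hcard : (s.card : ℝ) ≠ 0 := Nat.cast_ne_zero.mpr hμ.nonempty.card_ne_zero
  have hint (i) (hi : i ∈ s) : Integrable (fun x => f (τ i x)) μ :=
    memLp_one_iff_integrable.mp (hμ.memLp_comp hi (memLp_one_iff_integrable.mpr hf))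
  have hmap {i : ι} (hi : i ∈ s) : Integrable f (μ.map (τ i)) :=
    hf.of_measure_le_smul (ENNReal.natCast_ne_top _) (hμ.map_le hi)
  rw [eq_comm, ← inv_smul_smul₀ hcard (∫ x, f x ∂μ)]
  calc (s.card : ℝ)⁻¹ • (s.card : ℝ) • ∫ x, f x ∂μ
      = (s.card : ℝ)⁻¹ • ∫ x, f x ∂((s.card : ℝ≥0∞) • μ) := by
        rw [integral_smul_measure, ENNReal.toReal_natCast]
    _ = (s.card : ℝ)⁻¹ • ∑ i ∈ s, ∫ x, f (τ i x) ∂μ := by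
        rw [hμ.card_smul, integral_finsetSum_measure fun i hi => hmap hi]
        congr 1
        exact Finset.sum_congr rfl fun i hi =>
          integral_map (hμ.measurable i hi).aemeasurable (hmap hi).aestronglyMeasurable
    _ = ∫ x, average s τ f x ∂μ := by
        simp only [average]
        rw [integral_smul, integral_finsetSum s hint]

end IsStationary

end StationaryMeasure

section BoundedSupport

attribute [local instance] Matrix.linftyOpNormedRing Matrix.linftyOpNormedAlgebra
  Matrix.linftyOpNormedAddCommGroup

variable {ι n : Type*} [Fintype n] [DecidableEq n] {s : Finset ι} {A : Matrix n n ℝ}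
  {v : ι → n → ℝ} {μ : Measure (n → ℝ)}

theorem IsStationary.measure_norm_pow_mulVec_le
    (hμ : IsStationary s (fun i x => A *ᵥ (x + v i)) μ) {β : ℝ} (hv : ∀ i ∈ s, ‖v i‖ ≤ β)
    (k : ℕ) (r : ℝ) :
    μ {x | ‖A ^ k *ᵥ x‖ ≤ r} ≤ μ {x | ‖x‖ ≤ r + ∑ j ∈ Finset.range k, ‖A ^ (j + 1)‖ * β} := by
  induction k generalizing r with
  | zero => simp
  | succ k ih =>
    refine (hμ.measure_le_of_subset_preimage (V := {x | ‖A ^ k *ᵥ x‖ ≤ r + ‖A ^ (k + 1)‖ * β})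
      ?_ fun i hi x hx => ?_).trans ((ih _).trans_eq ?_)
    · exact measurableSet_le (by fun_prop) measurable_const
    · have hsplit : A ^ k *ᵥ (A *ᵥ (x + v i)) = A ^ (k + 1) *ᵥ x + A ^ (k + 1) *ᵥ v i := by
        rw [Matrix.mulVec_mulVec, ← pow_succ, Matrix.mulVec_add]
      calc ‖A ^ k *ᵥ (A *ᵥ (x + v i))‖ ≤ ‖A ^ (k + 1) *ᵥ x‖ + ‖A ^ (k + 1) *ᵥ v i‖ :=
            hsplit ▸ norm_add_le _ _
        _ ≤ r + ‖A ^ (k + 1)‖ * β := by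
            refine add_le_add hx ((Matrix.linfty_opNorm_mulVec _ _).trans ?_)
            gcongr
            exact hv i hi
    · rw [Finset.sum_range_succ, add_assoc, add_comm (‖A ^ (k + 1)‖ * β)]

theorem IsStationary.exists_ae_norm_le [IsProbabilityMeasure μ]
    (hμ : IsStationary s (fun i x => A *ᵥ (x + v i)) μ)
    (hA : Summable fun k : ℕ => ‖A ^ k‖) : ∃ K : ℝ, ∀ᵐ x ∂μ, ‖x‖ ≤ K := by
  obtain ⟨β, hβ⟩ := (s.image fun i => ‖v i‖).bddAbove
  replace hβ : ∀ i ∈ s, ‖v i‖ ≤ max β 0 := fun i hi =>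
    (hβ (Finset.mem_image_of_mem _ hi)).trans (le_max_left _ _)
  let K : ℝ := 1 + ∑' j, ‖A ^ (j + 1)‖ * max β 0
  have hball (m : ℕ) : μ (Metric.closedBall 0 m) ≤ μ {x | ‖x‖ ≤ K} := by
    have hlim : Tendsto (fun k => ‖A ^ k‖ * m) atTop (𝓝 0) := by
      simpa using hA.tendsto_atTop_zero.mul_const (m : ℝ)
    obtain ⟨k, hk⟩ := (hlim.eventually (ge_mem_nhds one_pos)).exists
    calc μ (Metric.closedBall 0 m) ≤ μ {x | ‖A ^ k *ᵥ x‖ ≤ 1} := measure_mono fun x hx => by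
          refine (Matrix.linfty_opNorm_mulVec _ _).trans (le_trans ?_ hk)
          gcongr
          exact mem_closedBall_zero_iff.mp hx
      _ ≤ _ := hμ.measure_norm_pow_mulVec_le hβ k 1
      _ ≤ μ {x | ‖x‖ ≤ K} := measure_mono fun x hx => le_trans hx <| add_le_add le_rfl <|
          (((summable_nat_add_iff 1).mpr hA).mul_right _).sum_le_tsum _ fun _ _ => by positivity
  have hfull : μ {x | ‖x‖ ≤ K} = 1 := by
    refine prob_le_one.antisymm ?_
    have hlim := tendsto_measure_iUnion_atTop (μ := μ) (s := fun m : ℕ =>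
      Metric.closedBall (0 : n → ℝ) m) fun _ _ h => Metric.closedBall_subset_closedBall (mod_cast h)
    rw [Metric.iUnion_closedBall_nat, measure_univ] at hlim
    exact le_of_tendsto' hlim hball
  exact ⟨K, (mem_ae_iff_prob_eq_one (measurableSet_le measurable_norm measurable_const)).mpr hfull⟩

end BoundedSupport

section Exponentials

variable {d : ℕ}

theorem expo_add_left (s t x : Fin d → ℝ) : expo (s + t) x = expo s x * expo t x := by
  rw [expo, expo, expo, ← Complex.exp_add, add_dotProduct]
  push_cast
  ring_nf

theorem expo_comm (t x : Fin d → ℝ) : expo t x = expo x t := by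
  rw [expo, expo, dotProduct_comm]

theorem expo_add_right (t x y : Fin d → ℝ) : expo t (x + y) = expo t x * expo t y := by
  simp only [expo_comm t, expo_add_left]

theorem conj_expo (t x : Fin d → ℝ) : conj (expo t x) = expo (-t) x := by
  rw [expo, expo, ← Complex.exp_conj, neg_dotProduct]
  simp only [map_mul, map_ofNat, Complex.conj_ofReal, Complex.conj_I, Complex.ofReal_neg,
    mul_neg, neg_mul]

theorem expo_mulVec (M : Matrix (Fin d) (Fin d) ℝ) (t x : Fin d → ℝ) :
    expo t (M *ᵥ x) = expo (Mᵀ *ᵥ t) x := by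
  rw [expo, expo, Matrix.dotProduct_mulVec, Matrix.mulVec_transpose]

theorem toReal_add (s t : Fin d → ℤ) : toReal (s + t) = toReal s + toReal t :=
  funext fun _ => Int.cast_add _ _

theorem toReal_zero : toReal (0 : Fin d → ℤ) = 0 :=
  funext fun _ => Int.cast_zero

theorem toReal_mulVec (M : Matrix (Fin d) (Fin d) ℤ) (s : Fin d → ℤ) :
    toReal (M *ᵥ s) = realMatrix M *ᵥ toReal s :=
  funext fun i => RingHom.map_mulVec (Int.castRingHom ℝ) M s i

theorem expo_toReal_toReal (s b : Fin d → ℤ) : expo (toReal s) (toReal b) = 1 := by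
  have hdot : toReal s ⬝ᵥ toReal b = ((s ⬝ᵥ b : ℤ) : ℝ) := by simp [toReal, dotProduct]
  rw [expo, hdot, Complex.exp_eq_one_iff]
  exact ⟨s ⬝ᵥ b, by push_cast; ring⟩

theorem integrable_expo_mul {μ : Measure (Fin d → ℝ)} {f : (Fin d → ℝ) → ℂ}
    (hf : Integrable f μ) (t : Fin d → ℝ) : Integrable (fun x => expo t x * f x) μ :=
  hf.bdd_mul (c := 1) (continuous_expo t).aestronglyMeasurable
    (Eventually.of_forall fun x => (norm_expo t x).le)

theorem norm_expoLp (μ : Measure (Fin d → ℝ)) [IsProbabilityMeasure μ] (t : Fin d → ℝ) :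
    ‖expoLp μ t‖ = 1 := by
  rw [expoLp, Lp.norm_toLp, eLpNorm_congr_norm_ae (g := fun _ => (1 : ℂ))
    (Eventually.of_forall fun x => by simp [norm_expo])]
  simp [eLpNorm_const _ two_ne_zero (IsProbabilityMeasure.ne_zero μ)]

variable (μ : Measure (Fin d → ℝ)) [IsFiniteMeasure μ]

theorem coeFn_expoLp (t : Fin d → ℝ) : expoLp μ t =ᵐ[μ] expo t :=
  (memLp_expo μ t).coeFn_toLp

theorem inner_expoLp (t : Fin d → ℝ) (f : Lp ℂ 2 μ) :
    ⟪expoLp μ t, f⟫_ℂ = ∫ x, conj (expo t x) * f x ∂μ := by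
  rw [L2.inner_def]
  refine integral_congr_ae ?_
  filter_upwards [coeFn_expoLp μ t] with x hx
  rw [hx, RCLike.inner_apply, mul_comm]

end Exponentials

section BranchOperators

variable {d : ℕ} {R : Matrix (Fin d) (Fin d) ℤ} {B : Finset (Fin d → ℤ)}
  {μ : Measure (Fin d → ℝ)}

theorem continuous_tau (R : Matrix (Fin d) (Fin d) ℤ) (b : Fin d → ℤ) : Continuous (tau R b) :=
  continuous_const.matrix_mulVec (continuous_id.add continuous_const)

theorem IsSelfAffineMeasure.nonempty [IsProbabilityMeasure μ] (hμ : IsSelfAffineMeasure R B μ) :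
    B.Nonempty := by
  by_contra! hempty
  simpa [hempty] using hμ Set.univ MeasurableSet.univ

theorem IsSelfAffineMeasure.isStationary [IsProbabilityMeasure μ]
    (hμ : IsSelfAffineMeasure R B μ) : IsStationary B (tau R) μ where
  nonempty := hμ.nonempty
  measurable b _ := (continuous_tau R b).measurable
  card_smul := by
    have hcard : (B.card : ℝ≥0∞) ≠ 0 := Nat.cast_ne_zero.mpr hμ.nonempty.card_ne_zero
    ext E hE
    rw [Measure.smul_apply, Measure.finsetSum_apply, hμ E hE, smul_eq_mul, ← mul_assoc,
      ENNReal.mul_inv_cancel hcard (ENNReal.natCast_ne_top _), one_mul]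
    exact Finset.sum_congr rfl fun b _ =>
      (Measure.map_apply (continuous_tau R b).measurable hE).symm

theorem expo_tau (t : Fin d → ℝ) (b : Fin d → ℤ) (x : Fin d → ℝ) :
    expo t (tau R b x) =
      expo (((realMatrix R)ᵀ)⁻¹ *ᵥ t) x * expo (((realMatrix R)ᵀ)⁻¹ *ᵥ t) (toReal b) := by
  rw [tau, expo_mulVec, Matrix.transpose_nonsing_inv, expo_add_right]

theorem IsExpansive.expo_transpose_mulVec_tau (hR : IsExpansive R) (s b : Fin d → ℤ)
    (x : Fin d → ℝ) : expo (toReal (Rᵀ *ᵥ s)) (tau R b x) = expo (toReal s) x := by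
  have hinv : ((realMatrix R)ᵀ)⁻¹ *ᵥ toReal (Rᵀ *ᵥ s) = toReal s := by
    rw [toReal_mulVec, Matrix.mulVec_mulVec]
    change (((realMatrix R)ᵀ)⁻¹ * (realMatrix R)ᵀ) *ᵥ toReal s = toReal s
    rw [Matrix.nonsing_inv_mul _ (Matrix.isUnit_det_transpose _ hR.isUnit_det),
      Matrix.one_mulVec]
  rw [expo_tau, hinv, expo_toReal_toReal, mul_one]

theorem conj_expo_tau_mul_expo_tau (l b : Fin d → ℤ) (t x : Fin d → ℝ) :
    conj (expo (toReal l) (tau R b x)) * expo t (tau R b x) =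
      expo (toReal b) (dualMap R l t) * expo (dualMap R l t) x := by
  rw [conj_expo, ← expo_add_left, expo_tau, neg_add_eq_sub, expo_comm (toReal b), mul_comm,
    dualMap]

/-- The branch operator `f ↦ N⁻¹ ∑_b conj (a e_l(τ_b x)) f(τ_b x)` on functions. -/
def branchFun (R : Matrix (Fin d) (Fin d) ℤ) (B : Finset (Fin d → ℤ)) (l : Fin d → ℤ) (a : ℂ)
    (f : (Fin d → ℝ) → ℂ) : (Fin d → ℝ) → ℂ :=
  average B (tau R) fun y => conj (a * expo (toReal l) y) * f y

theorem IsStationary.memLp_branchFun (hμ : IsStationary B (tau R) μ) (l : Fin d → ℤ) (a : ℂ)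
    {f : (Fin d → ℝ) → ℂ} (hf : MemLp f 2 μ) : MemLp (branchFun R B l a f) 2 μ := by
  refine hμ.memLp_average (hf.of_le_mul (c := ‖a‖) ?_ (Eventually.of_forall fun x => ?_))
  · exact (Complex.continuous_conj.comp
      (continuous_const.mul (continuous_expo _))).aestronglyMeasurable.mul hf.1
  · simp [norm_expo]

/-- The branch operator on `L²(μ)`. Without overlaps it is the adjoint of the weighted isometry
`f ↦ a e_l · f ∘ 𝓡`, where `𝓡` is the common left inverse of the maps `τ_b`; the average over the
branches makes sense for overlapping images, too. -/
def branch (hμ : IsStationary B (tau R) μ) (l : Fin d → ℤ) (a : ℂ) (f : Lp ℂ 2 μ) :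
    Lp ℂ 2 μ :=
  (hμ.memLp_branchFun l a (Lp.memLp f)).toLp (branchFun R B l a f)

theorem coeFn_branch (hμ : IsStationary B (tau R) μ) (l : Fin d → ℤ) (a : ℂ) (f : Lp ℂ 2 μ) :
    branch hμ l a f =ᵐ[μ] branchFun R B l a f := MemLp.coeFn_toLp _

theorem inner_expoLp_branch [IsFiniteMeasure μ] (hR : IsExpansive R) (hμ : IsStationary B (tau R) μ)
    (l : Fin d → ℤ) (a : ℂ) (s : Fin d → ℤ) (f : Lp ℂ 2 μ) :
    ⟪expoLp μ (toReal s), branch hμ l a f⟫_ℂ =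
      ⟪a • expoLp μ (toReal (l + Rᵀ *ᵥ s)), f⟫_ℂ := by
  let F : (Fin d → ℝ) → ℂ := fun y => conj a * (conj (expo (toReal (l + Rᵀ *ᵥ s)) y) * f y)
  have hF : Integrable F μ := by
    simp only [F, conj_expo]
    exact (integrable_expo_mul ((Lp.memLp f).integrable one_le_two) _).const_mul _
  have hbranch (x) : conj (expo (toReal s) x) * branchFun R B l a f x
      = average B (tau R) F x := by
    rw [branchFun, average, mul_smul_comm, Finset.mul_sum, average]
    congr 1
    refine Finset.sum_congr rfl fun b _ => ?_
    simp only [F, toReal_add, expo_add_left, hR.expo_transpose_mulVec_tau, map_mul]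
    ring
  calc ⟪expoLp μ (toReal s), branch hμ l a f⟫_ℂ
      = ∫ x, average B (tau R) F x ∂μ := by
        rw [inner_expoLp]
        refine integral_congr_ae ?_
        filter_upwards [coeFn_branch hμ l a f] with x hx
        rw [hx, hbranch]
    _ = ∫ x, F x ∂μ := hμ.integral_average hF
    _ = ⟪a • expoLp μ (toReal (l + Rᵀ *ᵥ s)), f⟫_ℂ := by
        rw [inner_smul_left, inner_expoLp, integral_const_mul]

theorem branch_expoLp [IsFiniteMeasure μ] (hμ : IsStationary B (tau R) μ) (l : Fin d → ℤ) (a : ℂ)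
    (t : Fin d → ℝ) :
    branch hμ l a (expoLp μ t) =
      (conj a * mask B (dualMap R l t)) • expoLp μ (dualMap R l t) := by
  have hfun (x) : branchFun R B l a (expo t) x =
      conj a * mask B (dualMap R l t) * expo (dualMap R l t) x := by
    simp only [branchFun, average, mask, map_mul, mul_assoc, conj_expo_tau_mul_expo_tau]
    rw [← Finset.mul_sum, ← Finset.sum_mul, Complex.real_smul]
    push_cast
    ring
  have hcongr : branchFun R B l a (expoLp μ t) =ᵐ[μ] branchFun R B l a (expo t) :=
    hμ.average_congr_ae <| by
      filter_upwards [coeFn_expoLp μ t] with y hy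
      rw [hy]
  refine Lp.ext ?_
  filter_upwards [coeFn_branch hμ l a (expoLp μ t), hcongr, Lp.coeFn_smul
    (conj a * mask B (dualMap R l t)) (expoLp μ (dualMap R l t)),
    coeFn_expoLp μ (dualMap R l t)] with x hbranch hx hsmul hexpo
  rw [hbranch, hx, hfun, hsmul, Pi.smul_apply, hexpo, smul_eq_mul]

end BranchOperators

section NormIdentity

theorem star_dotProduct_self {n : Type*} [Fintype n] (v : n → ℂ) :
    star v ⬝ᵥ v = ((∑ i, ‖v i‖ ^ 2 : ℝ) : ℂ) := by
  push_cast
  exact Finset.sum_congr rfl fun i _ => Complex.conj_mul' (v i)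

theorem sum_norm_sq_mulVec_of_conjTranspose_mul_self {m n : Type*} [Fintype m] [Fintype n]
    [DecidableEq n] {T : Matrix m n ℂ} (hT : Tᴴ * T = 1) (u : n → ℂ) :
    ∑ i, ‖(T *ᵥ u) i‖ ^ 2 = ∑ j, ‖u j‖ ^ 2 := by
  have hdot : star (T *ᵥ u) ⬝ᵥ (T *ᵥ u) = star u ⬝ᵥ u := by
    rw [Matrix.star_mulVec, ← Matrix.dotProduct_mulVec, Matrix.mulVec_mulVec, hT,
      Matrix.one_mulVec]
  rw [star_dotProduct_self, star_dotProduct_self] at hdot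
  exact_mod_cast hdot

theorem norm_sq_eq_integral_norm_sq {X : Type*} [MeasurableSpace X] {μ : Measure X}
    (f : Lp ℂ 2 μ) : ‖f‖ ^ 2 = ∫ x, ‖f x‖ ^ 2 ∂μ := by
  have hinner : ((‖f‖ ^ 2 : ℝ) : ℂ) = ((∫ x, ‖f x‖ ^ 2 ∂μ : ℝ) : ℂ) := by
    rw [← integral_complex_ofReal, Complex.ofReal_pow]
    refine (inner_self_eq_norm_sq_to_K (𝕜 := ℂ) f).symm.trans (integral_congr_ae ?_)
    filter_upwards with x
    simp
  exact_mod_cast hinner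

variable {d : ℕ} {R : Matrix (Fin d) (Fin d) ℤ} {B L : Finset (Fin d → ℤ)} {α : L → ℂ}

theorem norm_branchFun (f : (Fin d → ℝ) → ℂ) (x : Fin d → ℝ) (l : L) :
    ‖branchFun R B l.1 (α l) f x‖ =
      (√B.card)⁻¹ * ‖(weightMatrix R B L α *ᵥ fun b : B => conj (f (tau R b.1 x))) l‖ := by
  have hfactor : branchFun R B l.1 (α l) f x = (√B.card)⁻¹ •
      (conj (expo (((realMatrix R)ᵀ)⁻¹ *ᵥ toReal l.1) x) *
        conj ((weightMatrix R B L α *ᵥ fun b : B => conj (f (tau R b.1 x))) l)) := by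
    have hcard : (B.card : ℝ)⁻¹ = (√B.card)⁻¹ * (√B.card)⁻¹ := by
      rw [← mul_inv, Real.mul_self_sqrt (Nat.cast_nonneg _)]
    rw [branchFun, average, hcard, mul_smul, ← Finset.sum_coe_sort B, Matrix.mulVec, dotProduct,
      map_sum, Finset.mul_sum, Finset.smul_sum]
    congr 1
    refine Finset.sum_congr rfl fun b _ => ?_
    simp only [weightMatrix, Matrix.of_apply, map_mul, Complex.conj_conj, map_inv₀,
      Complex.conj_ofReal, expo_tau, Complex.real_smul, Complex.ofReal_inv]
    ring
  rw [hfactor, norm_smul, norm_mul, RCLike.norm_conj, RCLike.norm_conj, norm_expo, one_mul,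
    Real.norm_of_nonneg (by positivity)]

theorem sum_norm_sq_branchFun (hT : (weightMatrix R B L α)ᴴ * weightMatrix R B L α = 1)
    (f : (Fin d → ℝ) → ℂ) (x : Fin d → ℝ) :
    ∑ l : L, ‖branchFun R B l.1 (α l) f x‖ ^ 2 = average B (tau R) (fun y => ‖f y‖ ^ 2) x := by
  simp only [norm_branchFun, mul_pow, inv_pow, Real.sq_sqrt (Nat.cast_nonneg B.card),
    ← Finset.mul_sum, sum_norm_sq_mulVec_of_conjTranspose_mul_self hT, RCLike.norm_conj]
  rw [average, smul_eq_mul, ← Finset.sum_coe_sort B]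

theorem sum_norm_sq_branch {μ : Measure (Fin d → ℝ)} (hμ : IsStationary B (tau R) μ)
    (hT : (weightMatrix R B L α)ᴴ * weightMatrix R B L α = 1) (f : Lp ℂ 2 μ) :
    ∑ l : L, ‖branch hμ l.1 (α l) f‖ ^ 2 = ‖f‖ ^ 2 := by
  have hbranch (l : L) : ‖branch hμ l.1 (α l) f‖ ^ 2 =
      ∫ x, ‖branchFun R B l.1 (α l) f x‖ ^ 2 ∂μ := by
    rw [norm_sq_eq_integral_norm_sq]
    refine integral_congr_ae ?_
    filter_upwards [coeFn_branch hμ l.1 (α l) f] with x hx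
    rw [hx]
  calc ∑ l : L, ‖branch hμ l.1 (α l) f‖ ^ 2
      = ∑ l : L, ∫ x, ‖branchFun R B l.1 (α l) f x‖ ^ 2 ∂μ := by simp only [hbranch]
    _ = ∫ x, ∑ l : L, ‖branchFun R B l.1 (α l) f x‖ ^ 2 ∂μ :=
        (integral_finsetSum _ fun l _ => (hμ.memLp_branchFun l.1 (α l)
          (Lp.memLp f)).integrable_norm_pow two_ne_zero).symm
    _ = ∫ x, average B (tau R) (fun y => ‖f y‖ ^ 2) x ∂μ := by
        simp only [sum_norm_sq_branchFun hT]
    _ = ∫ x, ‖f x‖ ^ 2 ∂μ :=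
        hμ.integral_average ((Lp.memLp f).integrable_norm_pow two_ne_zero)
    _ = ‖f‖ ^ 2 := (norm_sq_eq_integral_norm_sq f).symm

end NormIdentity

section WordRecursion

variable {d : ℕ} {R : Matrix (Fin d) (Fin d) ℤ} {B L : Finset (Fin d → ℤ)} {α : L → ℂ}
  {μ : Measure (Fin d → ℝ)}

theorem frequency_nil (R : Matrix (Fin d) (Fin d) ℤ) : frequency R ([] : List L) = 0 :=
  Finset.sum_eq_zero fun i _ => i.elim0

theorem frequency_cons (R : Matrix (Fin d) (Fin d) ℤ) (l : L) (w : List L) :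
    frequency R (l :: w) = l.1 + Rᵀ *ᵥ frequency R w := by
  refine (Fin.sum_univ_succ (n := w.length) _).trans (congrArg₂ _ ?_ ?_)
  · exact (congrArg (· *ᵥ l.1) (pow_zero Rᵀ)).trans (Matrix.one_mulVec _)
  · rw [frequency, ← Matrix.mulVecLin_apply Rᵀ, map_sum]
    refine Finset.sum_congr rfl fun i _ => ?_
    rw [Matrix.mulVecLin_apply, Matrix.mulVec_mulVec, ← pow_succ']
    rfl

theorem weightedExpo_nil [IsFiniteMeasure μ] : weightedExpo R α μ Words.nil = expoLp μ 0 := by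
  simp only [weightedExpo, Words.nil, List.map_nil, List.prod_nil, one_smul, frequency_nil,
    toReal_zero]

theorem inner_weightedExpo_uncons [IsFiniteMeasure μ] (hR : IsExpansive R)
    (hμ : IsStationary B (tau R) μ) {hL : (0 : Fin d → ℤ) ∈ L} (hα : α ⟨0, hL⟩ = 1) (w : Words L)
    (f : Lp ℂ 2 μ) :
    ⟪weightedExpo R α μ w, f⟫_ℂ = ⟪weightedExpo R α μ (w.uncons hL).2,
      branch hμ (w.uncons hL).1.1 (α (w.uncons hL).1) f⟫_ℂ := by
  rw [weightedExpo, weightedExpo, inner_smul_left, inner_smul_left, inner_expoLp_branch hR,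
    inner_smul_left]
  obtain ⟨_ | ⟨l, w⟩, hw⟩ := w
  · simp [Words.uncons, Words.nil, frequency_nil, hα]
  · simp only [Words.uncons, List.map_cons, List.prod_cons, map_mul, frequency_cons]
    ring

theorem isBesselFamily_weightedExpo [IsProbabilityMeasure μ] (hR : IsExpansive R)
    (hμ : IsStationary B (tau R) μ) {hL : (0 : Fin d → ℤ) ∈ L} (hα : α ⟨0, hL⟩ = 1)
    (hT : (weightMatrix R B L α)ᴴ * weightMatrix R B L α = 1) :
    IsBesselFamily (weightedExpo R α μ) :=
  isBesselFamily_of_inner_uncons (sum_norm_sq_branch hμ hT) (inner_weightedExpo_uncons hR hμ hα)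
    (by rw [weightedExpo_nil, norm_expoLp])

theorem frameSum_expoLp_eq_sum [IsFiniteMeasure μ]
    (hbessel : IsBesselFamily (weightedExpo R α μ)) (hR : IsExpansive R)
    (hμ : IsStationary B (tau R) μ) {hL : (0 : Fin d → ℤ) ∈ L} (hα : α ⟨0, hL⟩ = 1)
    (t : Fin d → ℝ) :
    frameSum (weightedExpo R α μ) (expoLp μ t) = ∑ l : L, ‖α l‖ ^ 2 *
      ‖mask B (dualMap R l.1 t)‖ ^ 2 *
        frameSum (weightedExpo R α μ) (expoLp μ (dualMap R l.1 t)) := by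
  rw [hbessel.frameSum_eq_sum_of_inner_uncons (A := fun l => branch hμ l.1 (α l))
    (inner_weightedExpo_uncons hR hμ hα)]
  refine Finset.sum_congr rfl fun l _ => ?_
  rw [branch_expoLp, ← hbessel.norm_sq_analysisOp, ← hbessel.norm_sq_analysisOp, map_smul,
    norm_smul, norm_mul, RCLike.norm_conj, mul_pow, mul_pow]

theorem frameSum_expoLp_zero [IsProbabilityMeasure μ]
    (hbessel : IsBesselFamily (weightedExpo R α μ)) :
    frameSum (weightedExpo R α μ) (expoLp μ 0) = 1 := by
  refine le_antisymm (by simpa [norm_expoLp] using hbessel.frameSum_le (expoLp μ 0)) ?_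
  have hnil := le_hasSum (hbessel.hasSum_frameSum (expoLp μ 0)) Words.nil fun _ _ => sq_nonneg _
  rwa [weightedExpo_nil, inner_self_eq_norm_sq_to_K, norm_expoLp, RCLike.ofReal_one, one_pow,
    norm_one, one_pow] at hnil

end WordRecursion

section Totality

variable {d : ℕ} {μ : Measure (Fin d → ℝ)}

theorem fourierChar_dotProduct (t x : Fin d → ℝ) :
    (Real.fourierChar (t ⬝ᵥ x) : ℂ) = expo t x := by
  rw [Real.fourierChar_apply, expo]
  push_cast
  ring_nf

theorem measure_ext_of_integral_expo {ν : Measure (Fin d → ℝ)} [IsFiniteMeasure μ]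
    [IsFiniteMeasure ν] (h : ∀ t, ∫ x, expo t x ∂μ = ∫ x, expo t x ∂ν) : μ = ν := by
  refine ext_of_integral_char_eq (L := dotProductBilin ℝ ℝ) Real.continuous_fourierChar
    Real.fourierChar_ne_one (fun v hv hzero => hv ?_) ?_ fun t => ?_
  · exact dotProduct_self_eq_zero.mp (LinearMap.congr_fun hzero v)
  · simp only [dotProductBilin_apply_apply, dotProduct]
    fun_prop
  · simpa only [BoundedContinuousFunction.char_apply, dotProductBilin_apply_apply,
      fourierChar_dotProduct, expo_comm _ t] using h t

theorem integral_withDensity_ofReal {X : Type*} [MeasurableSpace X] {μ : Measure X} {g : X → ℝ}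
    (hg : Integrable g μ) (φ : X → ℂ) :
    ∫ x, φ x ∂μ.withDensity (fun x => ENNReal.ofReal (g x)) =
      ∫ x, φ x * ((max (g x) 0 : ℝ) : ℂ) ∂μ := by
  rw [integral_withDensity_eq_integral_toReal_smul₀ hg.1.aemeasurable.ennreal_ofReal
    (Eventually.of_forall fun _ => ENNReal.ofReal_lt_top)]
  simp only [ENNReal.toReal_ofReal', Complex.real_smul, mul_comm]

theorem ae_eq_zero_of_integral_expo_mul_ofReal_eq_zero {g : (Fin d → ℝ) → ℝ}
    (hg : Integrable g μ) (h : ∀ t, ∫ x, expo t x * (g x : ℂ) ∂μ = 0) : g =ᵐ[μ] 0 := by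
  have hpos (t) {u : (Fin d → ℝ) → ℝ} (hu : Integrable u μ) :
      Integrable (fun x => expo t x * ((max (u x) 0 : ℝ) : ℂ)) μ :=
    integrable_expo_mul hu.pos_part.ofReal t
  have heq : μ.withDensity (fun x => ENNReal.ofReal (g x)) =
      μ.withDensity (fun x => ENNReal.ofReal ((-g) x)) := by
    have := isFiniteMeasure_withDensity_ofReal hg.2
    have := isFiniteMeasure_withDensity_ofReal hg.neg.2
    refine measure_ext_of_integral_expo fun t => ?_
    rw [integral_withDensity_ofReal hg, integral_withDensity_ofReal hg.neg, ← sub_eq_zero,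
      ← integral_sub (hpos t hg) (hpos t hg.neg), ← h t]
    simp only [← mul_sub, ← Complex.ofReal_sub, Pi.neg_apply,
      max_zero_sub_max_neg_zero_eq_self]
  rw [withDensity_eq_iff hg.1.aemeasurable.ennreal_ofReal
    hg.neg.1.aemeasurable.ennreal_ofReal hg.lintegral_lt_top.ne] at heq
  filter_upwards [heq] with x hx
  have hmax := congrArg ENNReal.toReal hx
  rw [ENNReal.toReal_ofReal', ENNReal.toReal_ofReal'] at hmax
  rw [Pi.zero_apply, ← max_zero_sub_max_neg_zero_eq_self (g x), sub_eq_zero]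
  exact hmax

theorem re_ae_eq_zero_of_integral_expo_mul_eq_zero {f : (Fin d → ℝ) → ℂ} (hf : Integrable f μ)
    (h : ∀ t, ∫ x, expo t x * f x ∂μ = 0) : (fun x => (f x).re) =ᵐ[μ] 0 := by
  have hconj (t) : ∫ x, conj (expo (-t) x * f x) ∂μ = 0 := by
    rw [integral_conj, h, map_zero]
  refine ae_eq_zero_of_integral_expo_mul_ofReal_eq_zero hf.re fun t => ?_
  have hsplit (x) : expo t x * ((f x).re : ℂ) =
      2⁻¹ * (expo t x * f x + conj (expo (-t) x * f x)) := by
    rw [Complex.re_eq_add_conj, map_mul, conj_expo, neg_neg]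
    ring
  simp only [hsplit]
  rw [integral_const_mul, integral_add (integrable_expo_mul hf t), h, hconj, add_zero, mul_zero]
  exact (LinearIsometryEquiv.integrable_comp_iff Complex.conjLIE).mpr (integrable_expo_mul hf (-t))

theorem ae_eq_zero_of_integral_expo_mul_eq_zero {f : (Fin d → ℝ) → ℂ} (hf : Integrable f μ)
    (h : ∀ t, ∫ x, expo t x * f x ∂μ = 0) : f =ᵐ[μ] 0 := by
  have hI (t) : ∫ x, expo t x * (Complex.I * f x) ∂μ = 0 := by
    simp only [mul_left_comm _ Complex.I]
    rw [integral_const_mul, h, mul_zero]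
  filter_upwards [re_ae_eq_zero_of_integral_expo_mul_eq_zero hf h,
    re_ae_eq_zero_of_integral_expo_mul_eq_zero (hf.const_mul Complex.I) hI] with x hre him
  exact Complex.ext hre (by simpa using him)

theorem dense_span_range_expoLp [IsFiniteMeasure μ] :
    Dense (Submodule.span ℂ (Set.range (expoLp μ)) : Set (Lp ℂ 2 μ)) := by
  rw [Submodule.dense_iff_topologicalClosure_eq_top, Submodule.topologicalClosure_eq_top_iff,
    Submodule.eq_bot_iff]
  intro f hf
  refine Lp.eq_zero_iff_ae_eq_zero.mpr
    (ae_eq_zero_of_integral_expo_mul_eq_zero ((Lp.memLp f).integrable one_le_two) fun t => ?_)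
  have horth := (Submodule.mem_orthogonal _ _).mp hf _
    (Submodule.subset_span (Set.mem_range_self (-t)))
  simpa only [inner_expoLp, conj_expo, neg_neg] using horth

end Totality

section EntireExtension

variable {d : ℕ}

/-- The `i`-th coordinate function, truncated to `[-K, K]` so that it becomes a bounded function
without changing on the ball of radius `K`. -/
def truncatedCoord (K : ℝ) (i : Fin d) : (Fin d → ℝ) →ᵇ ℂ :=
  BoundedContinuousFunction.ofNormedAddCommGroup
    (fun x => ((max (-K) (min K (x i)) : ℝ) : ℂ)) (by fun_prop) |K| fun x => by
      rw [Complex.norm_real, Real.norm_eq_abs]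
      exact abs_le.mpr ⟨(neg_le_neg (le_abs_self K)).trans (le_max_left _ _),
        max_le (neg_le_abs K) ((min_le_left _ _).trans (le_abs_self K))⟩

theorem truncatedCoord_apply {K : ℝ} {x : Fin d → ℝ} (hx : ‖x‖ ≤ K) (i : Fin d) :
    truncatedCoord K i x = x i := by
  have hxi := abs_le.mp ((norm_le_pi_norm x i).trans hx)
  simp only [truncatedCoord, BoundedContinuousFunction.coe_ofNormedAddCommGroup]
  rw [min_eq_right hxi.2, max_eq_right hxi.1]

theorem boundedContinuousFunction_exp_apply {X : Type*} [TopologicalSpace X] (a : X →ᵇ ℂ)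
    (x : X) : NormedSpace.exp a x = Complex.exp (a x) := by
  rw [Complex.exp_eq_exp_ℂ]
  let eval : (X →ᵇ ℂ) →+* ℂ :=
    { toFun := fun b => b x
      map_one' := rfl
      map_mul' := fun _ _ => rfl
      map_zero' := rfl
      map_add' := fun _ _ => rfl }
  exact NormedSpace.map_exp eval (BoundedContinuousFunction.evalCLM ℂ x).continuous a

/-- The exponential `x ↦ exp(2πi z·x)` with complex frequency `z`. Truncating the coordinates of
`x` makes it a bounded function, whose dependence on `z` is entire in the supremum norm. -/
def complexExpo (K : ℝ) (z : Fin d → ℂ) : (Fin d → ℝ) →ᵇ ℂ :=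
  NormedSpace.exp (∑ i, (2 * Real.pi * Complex.I * z i) • truncatedCoord K i)

theorem differentiable_complexExpo (K : ℝ) :
    Differentiable ℂ (complexExpo K : (Fin d → ℂ) → (Fin d → ℝ) →ᵇ ℂ) := fun z =>
  (NormedSpace.exp_analytic (𝕂 := ℂ) _).differentiableAt.comp z (by fun_prop)

theorem complexExpo_ofReal_apply {K : ℝ} (t : Fin d → ℝ) {x : Fin d → ℝ} (hx : ‖x‖ ≤ K) :
    complexExpo K (fun i => (t i : ℂ)) x = expo t x := by
  rw [complexExpo, boundedContinuousFunction_exp_apply, expo, dotProduct]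
  push_cast
  simp only [BoundedContinuousFunction.coe_sum, Finset.sum_apply,
    BoundedContinuousFunction.coe_smul, truncatedCoord_apply hx, smul_eq_mul, Finset.mul_sum,
    mul_assoc]

variable {μ : Measure (Fin d → ℝ)} [IsFiniteMeasure μ]

theorem toLp_complexExpo_ofReal {K : ℝ} (hK : ∀ᵐ x ∂μ, ‖x‖ ≤ K) (t : Fin d → ℝ) :
    BoundedContinuousFunction.toLp 2 μ ℂ (complexExpo K fun i => (t i : ℂ)) = expoLp μ t := by
  refine Lp.ext ?_
  filter_upwards [hK, coeFn_expoLp μ t, BoundedContinuousFunction.coeFn_toLp 2 μ ℂ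
    (complexExpo K fun i => (t i : ℂ))] with x hx hexpo htoLp
  rw [hexpo, htoLp, complexExpo_ofReal_apply t hx]

theorem toLp_star_complexExpo_neg_ofReal {K : ℝ} (hK : ∀ᵐ x ∂μ, ‖x‖ ≤ K) (t : Fin d → ℝ) :
    BoundedContinuousFunction.toLp 2 μ ℂ (star (complexExpo K (-fun i => (t i : ℂ)))) =
      expoLp μ t := by
  have hneg : (-fun i => (t i : ℂ)) = fun i => ((-t) i : ℂ) := by
    ext i
    simp
  refine Lp.ext ?_
  filter_upwards [hK, coeFn_expoLp μ t, BoundedContinuousFunction.coeFn_toLp 2 μ ℂ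
    (star (complexExpo K (-fun i => (t i : ℂ))))] with x hx hexpo htoLp
  rw [hexpo, htoLp, BoundedContinuousFunction.star_apply, hneg, complexExpo_ofReal_apply (-t) hx,
    ← starRingEnd_apply, conj_expo, neg_neg]

theorem exists_differentiable_eq_norm_sq_apply_expoLp {F : Type*} [NormedAddCommGroup F]
    [InnerProductSpace ℂ F] {K : ℝ} (hK : ∀ᵐ x ∂μ, ‖x‖ ≤ K) (Θ : Lp ℂ 2 μ →L[ℂ] F) :
    ∃ h : (Fin d → ℂ) → ℂ, Differentiable ℂ h ∧
      ∀ t : Fin d → ℝ, h (fun i => (t i : ℂ)) = ((‖Θ (expoLp μ t)‖ ^ 2 : ℝ) : ℂ) := by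
  let T : ((Fin d → ℝ) →ᵇ ℂ) →L[ℂ] F := Θ.comp (BoundedContinuousFunction.toLp 2 μ ℂ)
  have hT (t : Fin d → ℝ) : T (complexExpo K fun i => (t i : ℂ)) = Θ (expoLp μ t) :=
    congrArg Θ (toLp_complexExpo_ofReal hK t)
  have hTstar (t : Fin d → ℝ) :
      T (star (complexExpo K (-fun i => (t i : ℂ)))) = Θ (expoLp μ t) :=
    congrArg Θ (toLp_star_complexExpo_neg_ofReal hK t)
  -- The inner product is conjugate-linear in its first argument, so `z` enters there through
  -- `star e_{-z}`, which is antiholomorphic in `z` and agrees with `e_z` at real points.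
  let J : ((Fin d → ℝ) →ᵇ ℂ) →L[ℂ] F →L[ℂ] ℂ := (innerSL ℂ).comp (T.comp
    (starL ℂ : ((Fin d → ℝ) →ᵇ ℂ) ≃L⋆[ℂ] ((Fin d → ℝ) →ᵇ ℂ)).toContinuousLinearMap)
  refine ⟨fun z => J (complexExpo K (-z)) (T (complexExpo K z)), ?_, fun t => ?_⟩
  · have hneg := (differentiable_complexExpo (d := d) K).comp differentiable_id.neg
    exact (J.differentiable.comp hneg).clm_apply
      (T.differentiable.comp (differentiable_complexExpo K))
  · change ⟪T (star (complexExpo K (-fun i => (t i : ℂ)))), _⟫_ℂ = _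
    rw [hT, hTstar, inner_self_eq_norm_sq_to_K]
    push_cast
    rfl

end EntireExtension

section TransferFixedPoint

variable {d : ℕ} {R : Matrix (Fin d) (Fin d) ℤ} {B L : Finset (Fin d → ℤ)} {α : L → ℂ}
  {μ : Measure (Fin d → ℝ)} [IsProbabilityMeasure μ]

theorem exists_isTransferFixed_eq_frameSum_expoLp (hR : IsExpansive R)
    (hμ : IsStationary B (tau R) μ) {hL : (0 : Fin d → ℤ) ∈ L} (hα : α ⟨0, hL⟩ = 1)
    (hbessel : IsBesselFamily (weightedExpo R α μ)) :
    ∃ h : (Fin d → ℂ) → ℂ, Differentiable ℂ h ∧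
      (∀ t : Fin d → ℝ, h (fun i => (t i : ℂ)) = frameSum (weightedExpo R α μ) (expoLp μ t)) ∧
      h 0 = 1 ∧ IsTransferFixed R B L α h := by
  obtain ⟨K, hK⟩ : ∃ K : ℝ, ∀ᵐ x ∂μ, ‖x‖ ≤ K :=
    IsStationary.exists_ae_norm_le hμ hR.summable_norm_inv_pow
  obtain ⟨h, hdiff, hnorm⟩ := exists_differentiable_eq_norm_sq_apply_expoLp hK hbessel.analysisOp
  have hval (t : Fin d → ℝ) :
      h (fun i => (t i : ℂ)) = frameSum (weightedExpo R α μ) (expoLp μ t) := by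
    rw [hnorm, hbessel.norm_sq_analysisOp]
  refine ⟨h, hdiff, hval, ?_, fun t => ?_⟩
  · have hzero := hval 0
    rw [frameSum_expoLp_zero hbessel, Complex.ofReal_one] at hzero
    simpa only [Pi.zero_apply, Complex.ofReal_zero, Pi.zero_def] using hzero
  · rw [hval t, frameSum_expoLp_eq_sum hbessel hR hμ hα]
    simp only [hval, Complex.ofReal_sum, Complex.ofReal_mul]

end TransferFixedPoint

end

end SelfAffine

open SelfAffine in
theorem theorem1p3_general {d : ℕ} (R : Matrix (Fin d) (Fin d) ℤ) (hR : IsExpansive R)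
    (B : Finset (Fin d → ℤ)) (μ : Measure (Fin d → ℝ)) [IsProbabilityMeasure μ]
    (hμ : IsSelfAffineMeasure R B μ)
    (L : Finset (Fin d → ℤ)) (hL : (0 : Fin d → ℤ) ∈ L) (α : L → ℂ)
    (hα : α ⟨0, hL⟩ = 1)
    (hT : (weightMatrix R B L α)ᴴ * weightMatrix R B L α = 1)
    (hfix : ∀ h : (Fin d → ℂ) → ℂ, Differentiable ℂ h →
      (∀ t : Fin d → ℝ, (h (fun i => (t i : ℂ))).im = 0 ∧
        0 ≤ (h (fun i => (t i : ℂ))).re ∧ (h (fun i => (t i : ℂ))).re ≤ 1) →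
      h 0 = 1 → IsTransferFixed R B L α h → ∀ z, h z = 1) :
    IsParsevalFrame (weightedExpo R α μ) := by
  have hstat : IsStationary B (tau R) μ := hμ.isStationary
  have hbessel : IsBesselFamily (weightedExpo R α μ) :=
    isBesselFamily_weightedExpo hR hstat hα hT
  obtain ⟨h, hdiff, hval, hzero, hfixed⟩ :=
    exists_isTransferFixed_eq_frameSum_expoLp hR hstat hα hbessel
  have hbounds (t : Fin d → ℝ) : (h (fun i => (t i : ℂ))).im = 0 ∧
      0 ≤ (h (fun i => (t i : ℂ))).re ∧ (h (fun i => (t i : ℂ))).re ≤ 1 := by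
    rw [hval]
    exact ⟨Complex.ofReal_im _, tsum_nonneg fun _ => sq_nonneg _,
      by simpa [norm_expoLp] using hbessel.frameSum_le (expoLp μ t)⟩
  have hone (t : Fin d → ℝ) : frameSum (weightedExpo R α μ) (expoLp μ t) = 1 := by
    rw [← Complex.ofReal_eq_one, ← hval]
    exact hfix h hdiff hbounds hzero hfixed _
  refine hbessel.isParsevalFrame_of_dense dense_span_range_expoLp fun t => ?_
  rw [hone, norm_expoLp, one_pow]

theorem theorem1p3 {d : ℕ} (R : Matrix (Fin d) (Fin d) ℤ) (hR : SelfAffine.IsExpansive R)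
    (B : Finset (Fin d → ℤ)) (hB : (0 : Fin d → ℤ) ∈ B)
    (μ : Measure (Fin d → ℝ)) [IsProbabilityMeasure μ]
    (hμ : SelfAffine.IsSelfAffineMeasure R B μ)
    (hoverlap : SelfAffine.NoOverlap R B μ)
    (L : Finset (Fin d → ℤ)) (hL : (0 : Fin d → ℤ) ∈ L) (α : L → ℂ)
    (hα : α ⟨0, hL⟩ = 1)
    (hT : (SelfAffine.weightMatrix R B L α)ᴴ * SelfAffine.weightMatrix R B L α = 1)
    (hfix : ∀ h : (Fin d → ℂ) → ℂ, Differentiable ℂ h →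
      (∀ t : Fin d → ℝ, (h (fun i => (t i : ℂ))).im = 0 ∧
        0 ≤ (h (fun i => (t i : ℂ))).re ∧ (h (fun i => (t i : ℂ))).re ≤ 1) →
      h 0 = 1 → SelfAffine.IsTransferFixed R B L α h → ∀ z, h z = 1) :
    SelfAffine.IsParsevalFrame (SelfAffine.weightedExpo R α μ) :=
  theorem1p3_general R hR B μ hμ L hL α hα hT hfix
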